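/- Let $\beta\in(0,e^{-1})$ and $\kappa>0$. Let $U$ be the workload of a $D/M/1$ queue sampled just before arrivals, $U_{k+1}=\max\{U_k+E_{k+1}-\ln\beta^{-1},0\}$ with $E_1,E_2,\dots$ i.i.d. exponential of unit rate, and put $Y=\kappa\exp(U)$; the law of $Y_1$ given $Y_0=z$ is that of $\kappa\exp(\max\{\ln(z/\kappa)+E_1-\ln\beta^{-1},0\})$, i.e. $\mathbb P[Y_1>v\mid Y_0=z]=\beta z/v$ for $v\ge\max\{\beta z,\kappa\}$. Let $\mathsf Z=[\min(1,\kappa),\infty)$ (so $\mathsf Z=[1,\infty)$ when $\kappa\ge1$), and let $n^\star:\mathsf Z\to\{1,2,\dots\}$ be measurable and bounded on bounded sets. Let $D=(Z,M)$ be the Markov chain on $\mathsf X=\{(z,m): z\in\mathsf Z,\ m\in\{1,\dots,n^\star(z)\}\}$ that moves from $(z,m)$ with $m\ge2$ to $(z,m-1)$, and from $(z,1)$ to $(z',n^\star(z'))$ where $z'$ has the law of $Y_1$ given $Y_0=z$. Let $\mathcal C=\{(z,m)\in\mathsf X: z\in[\kappa,\kappa/\beta]\}$ and $\tau_{\mathcal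 C}=\inf\{k\ge1: D_k\in\mathcal C\}$. Below, $f(z)\sim g(z)$ means $f(z)/g(z)\to1$ as $z\to\infty$. Then the equation $\ln\beta=\ln(1-\alpha)/\alpha$ has a unique solution $\alpha_\beta$ in $(0,1)$, and: (i) If $n^\star(z)\sim z^\gamma$ for some $\gamma\ge0$, then for every $\alpha\in(0,\alpha_\beta)$ and every $\eta\in(\gamma/\alpha,1]$ when $\gamma\in[0,\alpha_\beta)$, respectively every $\eta>\gamma/\alpha$ when $\gamma\ge\alpha_\beta$, there is a constant $C$ such that $\mathbb E_{(z,m)}[\tau_{\mathcal C}^{1/\eta}]\le C z^\alpha$ for all $(z,m)\in\mathsf X$. (ii) If $n^\star(z)\sim(\ln z)^\gamma$ for some $\gamma>0$, then for every $\alpha\in(0,\alpha_\beta)$ and every $\eta>0$ with $\eta<\{(1+\gamma)\alpha^{-1}\ln((1-\alpha)/\beta^\alpha)\}^{1/(1+\gamma)}$ there is a constant $C$ such that $\mathbb E_{(z,m)}[\exp(\eta\alpha\,\tau_{\mathcal C}^{1/(1+\gamma)})]\le C z^\alpha$ for all $(z,m)\in\mathsf X$. (iii) If $n^\star(z)=1$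 for all $z>\kappa/\beta$, then for every $\alpha\in(0,\alpha_\beta)$ there is a constant $C$ such that $\mathbb E_{(z,m)}[\{(1-\alpha)\beta^{-\alpha}\}^{\tau_{\mathcal C}}]\le C z^\alpha$ for all $(z,m)\in\mathsf X$. More generally, if $N$ is a natural number with $n^\star(z)\le N$ for all $z>\kappa/\beta$ (such an $N$ exists whenever $n^\star(z)\sim1$), then for every $\alpha\in(0,\alpha_\beta)$ there is a constant $C$ such that $\mathbb E_{(z,m)}[\{(1-\alpha)\beta^{-\alpha}\}^{\tau_{\mathcal C}/N}]\le C z^\alpha$ for all $(z,m)\in\mathsf X$. -/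

import Mathlib

open MeasureTheory ProbabilityTheory Filter Asymptotics
open scoped ENNReal

noncomputable section

namespace TameDomination

/-- One step of the workload of a `D/M/1` queue sampled just before arrivals: service time `e`,
interarrival time `ln β⁻¹`. -/
def workloadStep (β w e : ℝ) : ℝ := max (w + e - Real.log β⁻¹) 0

/-- One step of `Y = κ exp(U)`, where `U` is the workload, driven by the service time `e`. -/
def expWorkloadStep (β κ y e : ℝ) : ℝ :=
  κ * Real.exp (workloadStep β (Real.log (y / κ)) e)

lemma le_expWorkloadStep (β : ℝ) {κ : ℝ} (hκ : 0 < κ) (y e : ℝ) :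
    κ ≤ expWorkloadStep β κ y e := by
  have h : 1 ≤ Real.exp (workloadStep β (Real.log (y / κ)) e) :=
    Real.one_le_exp (le_max_right _ _)
  exact le_mul_of_one_le_right hκ.le h

lemma measurable_expWorkloadStep (β κ : ℝ) :
    Measurable fun p : ℝ × ℝ => expWorkloadStep β κ p.1 p.2 := by
  unfold expWorkloadStep workloadStep
  fun_prop

/-- The values of `Z`: the half-line `[1, ∞)` when `κ ≥ 1`, and `[κ, ∞)` when `κ < 1` (the
process `Y` then visits `[κ, 1)`). -/
abbrev Level (κ : ℝ) : Type := Set.Ici (min 1 κ)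

/-- `expWorkloadStep` as a map into the set of levels. -/
def levelStep (β : ℝ) {κ : ℝ} (hκ : 0 < κ) (p : Level κ × ℝ) : Level κ :=
  ⟨expWorkloadStep β κ p.1 p.2, (min_le_right 1 κ).trans (le_expWorkloadStep β hκ _ _)⟩

lemma measurable_levelStep (β : ℝ) {κ : ℝ} (hκ : 0 < κ) : Measurable (levelStep β hκ) :=
  Measurable.subtype_mk ((measurable_expWorkloadStep β κ).comp
    ((measurable_subtype_coe.comp measurable_fst).prodMk measurable_snd))

instance : IsProbabilityMeasure (expMeasure 1) := isProbabilityMeasure_expMeasure one_pos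

/-- The transition kernel of `Y`: the service time is exponential of unit rate. -/
def expWorkloadKernel (β : ℝ) {κ : ℝ} (hκ : 0 < κ) : Kernel (Level κ) (Level κ) :=
  (Kernel.id ×ₖ Kernel.const (Level κ) (expMeasure 1)).map (levelStep β hκ)

instance (β : ℝ) {κ : ℝ} (hκ : 0 < κ) : IsMarkovKernel (expWorkloadKernel β hκ) :=
  Kernel.IsMarkovKernel.map _ (measurable_levelStep β hκ)

/-- The state space `{(z, m) : m ∈ {1, …, n(z)}}` of the dominating chain. -/
abbrev State {κ : ℝ} (n : Level κ → ℕ) : Type :=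
  {x : Level κ × ℕ // 1 ≤ x.2 ∧ x.2 ≤ n x.1}

/-- `(z, m) ↦ (z, m - 1)` (used only where `m ≥ 2`). -/
def countDown {κ : ℝ} {n : Level κ → ℕ} (x : State n) : State n :=
  ⟨(x.1.1, max (x.1.2 - 1) 1), le_max_right _ _,
    max_le ((Nat.sub_le _ _).trans x.2.2) (x.2.1.trans x.2.2)⟩

/-- `z ↦ (z, n(z))`. -/
def refill {κ : ℝ} {n : Level κ → ℕ} (hn : ∀ z, 1 ≤ n z) (z : Level κ) : State n :=
  ⟨(z, n z), hn z, le_rfl⟩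

lemma measurable_countDown {κ : ℝ} {n : Level κ → ℕ} :
    Measurable (countDown : State n → State n) := by
  refine Measurable.subtype_mk (Measurable.prodMk (by fun_prop) ?_)
  exact (Measurable.of_discrete (f := fun m : ℕ => max (m - 1) 1)).comp
    (measurable_snd.comp measurable_subtype_coe)

lemma measurable_refill {κ : ℝ} {n : Level κ → ℕ} (hn : ∀ z, 1 ≤ n z) (hm : Measurable n) :
    Measurable (refill hn) :=
  Measurable.subtype_mk (measurable_id.prodMk hm)

lemma measurableSet_two_le {κ : ℝ} {n : Level κ → ℕ} :
    MeasurableSet {x : State n | 2 ≤ x.1.2} :=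
  measurableSet_le measurable_const (measurable_snd.comp measurable_subtype_coe)

/-- The transition kernel of the dominating chain `D = (Z, M)`: from `(z, m)` with `m ≥ 2` move to
`(z, m - 1)`; from `(z, 1)` move to `(z', n(z'))`, with `z'` drawn from the law of `Y₁` given
`Y₀ = z`. -/
def dominatingKernel (β : ℝ) {κ : ℝ} (hκ : 0 < κ) {n : Level κ → ℕ} (_hm : Measurable n)
    (hn : ∀ z, 1 ≤ n z) : Kernel (State n) (State n) :=
  Kernel.piecewise measurableSet_two_le
    (Kernel.deterministic countDown measurable_countDown)
    (((expWorkloadKernel β hκ).map (refill hn)).comap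
      (fun x => x.1.1) (measurable_fst.comp measurable_subtype_coe))

instance (β : ℝ) {κ : ℝ} (hκ : 0 < κ) {n : Level κ → ℕ} (hm : Measurable n)
    (hn : ∀ z, 1 ≤ n z) : IsMarkovKernel (dominatingKernel β hκ hm hn) := by
  have : IsMarkovKernel ((expWorkloadKernel β hκ).map (refill hn)) :=
    Kernel.IsMarkovKernel.map _ (measurable_refill hn hm)
  unfold dominatingKernel
  infer_instance

/-- The law on path space of the time-homogeneous Markov chain with transition kernel `P`
started at `x`. -/
def pathLaw {X : Type*} [MeasurableSpace X] (P : Kernel X X) [IsMarkovKernel P] (x : X) :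
    Measure (ℕ → X) :=
  Kernel.traj (X := fun _ => X)
    (fun k => P.comap (fun h : (Finset.Iic k → X) => h ⟨k, Finset.mem_Iic.2 le_rfl⟩)
      (measurable_pi_apply _)) 0 (fun _ => x)

/-- The return time `inf {k ≥ 1 : ω k ∈ A}`, equal to `∞` if there is no such `k`. -/
def returnTime {X : Type*} (A : Set X) (ω : ℕ → X) : ℕ∞ :=
  ⨅ (k : ℕ) (_ : 1 ≤ k ∧ ω k ∈ A), (k : ℕ∞)

/-- `R(t)` in `[0, ∞]`, with `R(∞) = ∞` (used for rates `R` increasing to `∞`). -/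
def extendRate (R : ℕ → ℝ) : ℕ∞ → ℝ≥0∞
  | ⊤ => ⊤
  | (t : ℕ) => ENNReal.ofReal (R t)

/-- The set `{(z, m) : z ∈ [κ, κ/β]}`. -/
def returnSet (β : ℝ) {κ : ℝ} (n : Level κ → ℕ) : Set (State n) :=
  {x | (x.1.1 : ℝ) ∈ Set.Icc κ (κ / β)}

/-- `E_{(z,m)}[R(τ)]` for the dominating chain started at `x = (z, m)`, where `τ` is the return
time to `{z ∈ [κ, κ/β]}`; a value in `[0, ∞]`. -/
def returnMoment (β : ℝ) {κ : ℝ} (hκ : 0 < κ) {n : Level κ → ℕ} (hm : Measurable n)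
    (hn : ∀ z, 1 ≤ n z) (R : ℕ → ℝ) (x : State n) : ℝ≥0∞ :=
  ∫⁻ ω, extendRate R (returnTime (returnSet β n) ω) ∂(pathLaw (dominatingKernel β hκ hm hn) x)

end TameDomination

end

/-! A jump of `Y` multiplies `z` by `β * exp E` unless the floor `κ` intervenes. Since `E[exp (α E)]
= 1 / (1 - α)`, the mean of `z ^ α` after a jump is at most `max z (κ / β) ^ α / ρ` with `ρ = (1 -
α) * β ^ (-α)`. For `α` in `(0, 1)`, `ρ > 1` exactly when `α < αβ`, because `log (1 - a) / a` is
strictly decreasing. The moments of the return time reflect a balance between this gain per jump and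
the delay `n z`.

The balance is expressed by a time-dependent Lyapunov function: if `W t ≥ R t` and one step of the
chain, paid off with `R (t + 1)` on return, does not increase the mean of `W`, then stopping and
Fatou give `E[R τ] ≤ W 0` (`lintegral_extendRate_returnTime_le`).

Here `W t (z, m) = F (t + m) (max z (κ / β))`. The countdown keeps `t + m` fixed, so only the refill
and the jump matter (`exists_returnMoment_le`). In every regime `B` is `F` with `z ^ α` replaced by
`ρ * z ^ α`: the delay must cost no more than this factor, and the jump must give it back. `F`
combines `R t` with `z ^ α` by a product for geometric rates, a sum for powers at most one, an
`L^(1/η)` sum for powers at least one, and the exponential of an `ℓ^q` sum with `q = 1 + γ` for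
subexponential rates. The jump estimate is then linearity, Minkowski, or Jensen for a function
concave on a half-line (`exp_powerSum_le_tangent`). -/

noncomputable section

namespace TameDomination

/-! ### Return-time moments of a Markov chain from a supersolution -/

section

section PathLaw

variable {X : Type*}

/-- Finite paths which avoid `A` at the times `1, …, k`. -/
def avoids (A : Set X) (k : ℕ) : Set (Finset.Iic k → X) :=
  {y | ∀ i : Finset.Iic k, 1 ≤ (i : ℕ) → y i ∉ A}

/-- The indicator of the event that the return time to `A` exceeds `k`. -/
def survival (A : Set X) (k : ℕ) (ω : ℕ → X) : ℝ≥0∞ :=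
  (avoids A k).indicator 1 (Preorder.frestrictLe k ω)

lemma survival_of_forall {A : Set X} {k : ℕ} {ω : ℕ → X} (h : ∀ i, 1 ≤ i → i ≤ k → ω i ∉ A) :
    survival A k ω = 1 := by
  rw [survival, Set.indicator_of_mem]
  · rfl
  · exact fun i hi => h i hi (Finset.mem_Iic.1 i.2)

lemma survival_of_mem {A : Set X} {i k : ℕ} {ω : ℕ → X} (h1 : 1 ≤ i) (hik : i ≤ k)
    (h : ω i ∈ A) : survival A k ω = 0 := by
  rw [survival, Set.indicator_of_notMem]
  exact fun hc => hc ⟨i, Finset.mem_Iic.2 hik⟩ h1 h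

open Classical in
lemma survival_succ (A : Set X) (k : ℕ) (ω : ℕ → X) :
    survival A (k + 1) ω = survival A k ω * if ω (k + 1) ∈ A then 0 else 1 := by
  by_cases h : ∀ i, 1 ≤ i → i ≤ k → ω i ∉ A
  · rw [survival_of_forall h, one_mul]
    split_ifs with hk
    · exact survival_of_mem (by omega) le_rfl hk
    · refine survival_of_forall fun i h1 hi => ?_
      rcases Nat.le_succ_iff.1 hi with hi | rfl
      exacts [h i h1 hi, hk]
  · push Not at h
    obtain ⟨i, h1, hi, hA⟩ := h
    rw [survival_of_mem h1 hi hA, survival_of_mem h1 (hi.trans k.le_succ) hA, zero_mul]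

variable {A : Set X} {R : ℕ → ℝ} {W : ℕ → X → ℝ≥0∞}

open Classical in
/-- The process `W` stopped with the value `R` at the first return to `A`. -/
def stoppedValue (A : Set X) (R : ℕ → ℝ) (W : ℕ → X → ℝ≥0∞) (k : ℕ) (ω : ℕ → X) : ℝ≥0∞ :=
  ∑ j ∈ Finset.range k, survival A j ω * (if ω (j + 1) ∈ A then ENNReal.ofReal (R (j + 1)) else 0)
    + survival A k ω * W k (ω k)

/-- If the return occurs, its term of the sum is present for all large `k`. If it never occurs, the
surviving term dominates `R k`, which diverges. -/
lemma extendRate_le_liminf (hR : Tendsto R atTop atTop)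
    (hRW : ∀ t y, ENNReal.ofReal (R t) ≤ W t y) (ω : ℕ → X) :
    extendRate R (returnTime A ω) ≤ liminf (fun k => stoppedValue A R W k ω) atTop := by
  classical
  by_cases h : ∃ k, 1 ≤ k ∧ ω k ∈ A
  · have hτ : returnTime A ω = (Nat.find h : ℕ) := by
      refine le_antisymm (iInf₂_le (Nat.find h) (Nat.find_spec h)) (le_iInf₂ fun k hk => ?_)
      exact_mod_cast Nat.find_min' h hk
    obtain ⟨h1, hmem⟩ := Nat.find_spec h
    obtain ⟨j, hj⟩ := Nat.exists_eq_add_of_le' h1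
    rw [hτ]
    refine le_liminf_of_le (by isBoundedDefault) ?_
    filter_upwards [eventually_ge_atTop (Nat.find h)] with k hk
    have hs : survival A j ω = 1 := survival_of_forall fun i hi hij hA =>
      Nat.find_min h (by omega) ⟨hi, hA⟩
    have hle := Finset.single_le_sum (f := fun j => survival A j ω *
      (if ω (j + 1) ∈ A then ENNReal.ofReal (R (j + 1)) else 0)) (s := Finset.range k)
      (fun _ _ => zero_le) (Finset.mem_range.2 (show j < k by omega))
    rw [hj] at hmem
    simp only [hs, hmem, if_true, one_mul] at hle
    rw [hj]
    exact hle.trans le_self_add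
  · push Not at h
    have hτ : returnTime A ω = ⊤ := by
      simp only [returnTime, iInf_eq_top]
      exact fun i hi => absurd hi.2 (h i hi.1)
    have ht : Tendsto (fun k => stoppedValue A R W k ω) atTop (nhds ⊤) := by
      refine tendsto_nhds_top_mono (ENNReal.tendsto_ofReal_nhds_top.2 hR) (Eventually.of_forall fun k => ?_)
      refine (hRW k (ω k)).trans ?_
      have hs : survival A k ω = 1 := survival_of_forall fun i hi _ => h i hi
      simp only [stoppedValue, hs, one_mul]
      exact le_add_self
    rw [ht.liminf_eq]
    exact le_top

variable [MeasurableSpace X]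

/-- The kernel `P`, applied to the last coordinate of a finite path. -/
abbrev lastKernel (P : Kernel X X) (k : ℕ) : Kernel (Finset.Iic k → X) X :=
  P.comap (fun h : (Finset.Iic k → X) => h ⟨k, Finset.mem_Iic.2 le_rfl⟩) (measurable_pi_apply _)

lemma lintegral_pathLaw_frestrictLe (P : Kernel X X) [IsMarkovKernel P] (x : X) (k : ℕ)
    {f : (Finset.Iic k → X) → ℝ≥0∞} (hf : Measurable f) :
    ∫⁻ ω, f (Preorder.frestrictLe k ω) ∂pathLaw P x
      = ∫⁻ y, f y ∂Kernel.partialTraj (X := fun _ => X) (lastKernel P) 0 k (fun _ => x) := by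
  rw [← Kernel.traj_map_frestrictLe_apply, lintegral_map hf (Preorder.measurable_frestrictLe k)]
  rfl

/-- The Markov property at time `k`. -/
lemma lintegral_pathLaw_succ (P : Kernel X X) [IsMarkovKernel P] (x : X) (k : ℕ)
    {G : (Finset.Iic k → X) → ℝ≥0∞} (hG : Measurable G) {h : X → ℝ≥0∞} (hh : Measurable h) :
    ∫⁻ ω, G (Preorder.frestrictLe k ω) * h (ω (k + 1)) ∂pathLaw P x
      = ∫⁻ ω, G (Preorder.frestrictLe k ω) * ∫⁻ y, h y ∂P (ω k) ∂pathLaw P x := by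
  have hPh : Measurable fun z => ∫⁻ y, h y ∂P z := hh.lintegral_kernel
  have hΦ : Measurable fun y : Finset.Iic (k + 1) → X =>
      G (Preorder.frestrictLe₂ (π := fun _ => X) k.le_succ y)
        * h (y ⟨k + 1, Finset.mem_Iic.2 le_rfl⟩) :=
    (hG.comp (Preorder.measurable_frestrictLe₂ _)).mul (hh.comp (measurable_pi_apply _))
  have hI : Measurable (IicProdIoc (X := fun _ => X) k (k + 1)) := measurable_IicProdIoc
  have e1 := lintegral_pathLaw_frestrictLe P x (k + 1)
    hΦ
  have e2 := lintegral_pathLaw_frestrictLe P x k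
    (f := fun y => G y * ∫⁻ z, h z ∂P (y ⟨k, Finset.mem_Iic.2 le_rfl⟩))
    (hG.mul (hPh.comp (measurable_pi_apply _)))
  refine e1.trans (Eq.trans ?_ e2.symm)
  -- The path up to `k + 1` is the path up to `k` followed by one kernel step, so it suffices to
  -- compare the inner integrals for a fixed history `y`.
  rw [Kernel.partialTraj_succ_eq_comp (Nat.zero_le k), Kernel.lintegral_comp _ _ _ hΦ]
  refine lintegral_congr fun y => ?_
  have : IsMarkovKernel ((lastKernel P k).map (MeasurableEquiv.piSingleton (X := fun _ => X) k)) :=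
    Kernel.IsMarkovKernel.map _ (MeasurableEquiv.measurable _)
  rw [Kernel.partialTraj_succ_self, Kernel.lintegral_map _ hI _ hΦ, ← lintegral_const_mul _ hh]
  refine (Kernel.lintegral_id_prod (hΦ.comp hI) _ _).trans ?_
  refine (Kernel.lintegral_map _ (MeasurableEquiv.measurable _) _
    ((hΦ.comp hI).comp measurable_prodMk_left)).trans ?_
  refine lintegral_congr fun z => ?_
  have h1 : Preorder.frestrictLe₂ (π := fun _ => X) k.le_succ
      (IicProdIoc (X := fun _ => X) k (k + 1) (y, MeasurableEquiv.piSingleton (X := fun _ => X) k z)) = y := by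
    ext i
    have hi : (i : ℕ) ≤ k := Finset.mem_Iic.1 i.2
    simp [IicProdIoc, hi]
  have h2 : IicProdIoc (X := fun _ => X) k (k + 1) (y, MeasurableEquiv.piSingleton (X := fun _ => X) k z)
      ⟨k + 1, Finset.mem_Iic.2 le_rfl⟩ = z := by
    simp [IicProdIoc, MeasurableEquiv.piSingleton]
  simp only [Function.comp_apply, h1, h2]

lemma measurableSet_avoids {A : Set X} (hA : MeasurableSet A) (k : ℕ) :
    MeasurableSet (avoids A k) := by
  have : avoids A k = ⋂ i : Finset.Iic k, {y | 1 ≤ (i : ℕ) → y i ∉ A} := by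
    ext; simp [avoids]
  rw [this]
  refine MeasurableSet.iInter fun i => ?_
  by_cases hi : 1 ≤ (i : ℕ)
  · simp only [hi, forall_const]
    exact (measurable_pi_apply (X := fun _ => X) i hA).compl
  · simp [hi]

lemma measurable_survival {A : Set X} (hA : MeasurableSet A) (k : ℕ) :
    Measurable (survival A k) :=
  (measurable_one.indicator (measurableSet_avoids hA k)).comp (Preorder.measurable_frestrictLe k)

open Classical in
lemma measurable_stoppedSum (hA : MeasurableSet A) (R : ℕ → ℝ) (k : ℕ) :
    Measurable fun ω : ℕ → X => ∑ j ∈ Finset.range k,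
      survival A j ω * (if ω (j + 1) ∈ A then ENNReal.ofReal (R (j + 1)) else 0) :=
  Finset.measurable_sum _ fun j _ => (measurable_survival hA j).mul
    (Measurable.ite (measurable_pi_apply _ hA) measurable_const measurable_const)

lemma measurable_stoppedValue (hA : MeasurableSet A) (hW : ∀ t, Measurable (W t)) (k : ℕ) :
    Measurable (stoppedValue A R W k) :=
  (measurable_stoppedSum hA R k).add
    ((measurable_survival hA k).mul ((hW k).comp (measurable_pi_apply k)))

open Classical in
lemma lintegral_stoppedValue_succ_le (P : Kernel X X) [IsMarkovKernel P] (hA : MeasurableSet A)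
    (hW : ∀ t, Measurable (W t))
    (hdrift : ∀ t x, ∫⁻ y, (if y ∈ A then ENNReal.ofReal (R (t + 1)) else W (t + 1) y) ∂P x ≤ W t x)
    (x : X) (k : ℕ) :
    ∫⁻ ω, stoppedValue A R W (k + 1) ω ∂pathLaw P x ≤ ∫⁻ ω, stoppedValue A R W k ω ∂pathLaw P x := by
  -- The new payoff and the new survival term share the factor `survival A k`, so a single step of
  -- `P` from `ω k` governs both.
  have hsplit : ∀ ω : ℕ → X, stoppedValue A R W (k + 1) ω
      = ∑ j ∈ Finset.range k,
          survival A j ω * (if ω (j + 1) ∈ A then ENNReal.ofReal (R (j + 1)) else 0)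
        + survival A k ω *
          (if ω (k + 1) ∈ A then ENNReal.ofReal (R (k + 1)) else W (k + 1) (ω (k + 1))) := by
    intro ω
    rw [stoppedValue, Finset.sum_range_succ, survival_succ, add_assoc, mul_assoc, ← mul_add]
    congr 2
    split_ifs <;> simp
  simp_rw [hsplit, stoppedValue]
  rw [lintegral_add_left (measurable_stoppedSum hA R k),
    lintegral_add_left (measurable_stoppedSum hA R k)]
  refine add_le_add le_rfl ?_
  refine (lintegral_pathLaw_succ P x k (measurable_one.indicator (measurableSet_avoids hA k))
    (h := fun y => if y ∈ A then ENNReal.ofReal (R (k + 1)) else W (k + 1) y)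
    (Measurable.ite hA measurable_const (hW _))).trans_le ?_
  exact lintegral_mono fun ω => mul_le_mul_right (hdrift k (ω k)) _

lemma pathLaw_initial (P : Kernel X X) [IsMarkovKernel P] (x : X) {f : X → ℝ≥0∞}
    (hf : Measurable f) : ∫⁻ ω, f (ω 0) ∂pathLaw P x = f x := by
  refine (lintegral_pathLaw_frestrictLe P x 0
    (f := fun y => f (y ⟨0, Finset.mem_Iic.2 le_rfl⟩)) (by fun_prop)).trans ?_
  rw [Kernel.partialTraj_self, Kernel.id_apply, lintegral_dirac' _ (by fun_prop)]

open Classical in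
/-- A supersolution of the one-step inequality bounds the moment of the return time. -/
theorem lintegral_extendRate_returnTime_le (P : Kernel X X) [IsMarkovKernel P]
    (hA : MeasurableSet A) (hR : Tendsto R atTop atTop) (hW : ∀ t, Measurable (W t))
    (hRW : ∀ t y, ENNReal.ofReal (R t) ≤ W t y)
    (hdrift : ∀ t x, ∫⁻ y, (if y ∈ A then ENNReal.ofReal (R (t + 1)) else W (t + 1) y) ∂P x ≤ W t x)
    (x : X) : ∫⁻ ω, extendRate R (returnTime A ω) ∂pathLaw P x ≤ W 0 x := by
  have hk : ∀ k, ∫⁻ ω, stoppedValue A R W k ω ∂pathLaw P x ≤ W 0 x := by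
    intro k
    induction k with
    | zero =>
      refine (le_of_eq ?_).trans (pathLaw_initial P x (hW 0)).le
      refine lintegral_congr fun ω => ?_
      have h0 : survival A 0 ω = 1 := survival_of_forall (by omega)
      simp [stoppedValue, h0]
    | succ k ih => exact (lintegral_stoppedValue_succ_le P hA hW hdrift x k).trans ih
  calc _ ≤ ∫⁻ ω, liminf (fun k => stoppedValue A R W k ω) atTop ∂pathLaw P x :=
        lintegral_mono fun ω => extendRate_le_liminf hR hRW ω
    _ ≤ liminf (fun k => ∫⁻ ω, stoppedValue A R W k ω ∂pathLaw P x) atTop :=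
        lintegral_liminf_le fun k => measurable_stoppedValue hA hW k
    _ ≤ W 0 x := liminf_le_of_le (by isBoundedDefault) fun b hb => by
        obtain ⟨k, h⟩ := hb.exists
        exact h.trans (hk k)

end PathLaw

end

/-! ### Drift of the exponential workload, and the moment bound for the dominating chain -/

section

lemma expMeasure_eq_withDensity (r : ℝ) :
    expMeasure r = volume.withDensity (exponentialPDF r) := rfl

/-- The exponential moments of the exponential distribution. -/
lemma lintegral_exp_mul_expMeasure {a : ℝ} (ha : a < 1) :
    ∫⁻ e, ENNReal.ofReal (Real.exp (a * e)) ∂expMeasure 1 = ENNReal.ofReal (1 - a)⁻¹ := by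
  have h1 : 0 < 1 - a := by linarith
  have hmeas : ∀ r, Measurable (exponentialPDF r) := fun r =>
    (measurable_exponentialPDFReal r).ennreal_ofReal
  rw [expMeasure_eq_withDensity, lintegral_withDensity_eq_lintegral_mul _ (hmeas 1) (by fun_prop)]
  -- Exponential tilting turns the density of rate `1` into a multiple of the density of rate `1 -
  -- a`.
  have : ∀ e, (exponentialPDF 1 * fun e => ENNReal.ofReal (Real.exp (a * e))) e
      = ENNReal.ofReal (1 - a)⁻¹ * exponentialPDF (1 - a) e := by
    intro e
    rw [Pi.mul_apply, exponentialPDF_eq, exponentialPDF_eq]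
    split_ifs
    · rw [← ENNReal.ofReal_mul (by positivity), ← ENNReal.ofReal_mul (by positivity),
        one_mul, ← Real.exp_add, ← mul_assoc, inv_mul_cancel₀ h1.ne', one_mul]
      ring_nf
    · simp
  rw [lintegral_congr this, lintegral_const_mul _ (hmeas _), lintegral_exponentialPDF_eq_one h1,
    mul_one]

lemma ae_nonneg_expMeasure : ∀ᵐ e ∂expMeasure 1, 0 ≤ e := by
  have hmeas : Measurable (exponentialPDF 1) := (measurable_exponentialPDFReal 1).ennreal_ofReal
  rw [expMeasure_eq_withDensity, ae_withDensity_iff hmeas]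
  refine Eventually.of_forall fun e he => ?_
  by_contra h
  exact he (exponentialPDF_of_neg (not_le.1 h))

/-- Below `κ / β` the step is dominated by the step from `κ / β`. -/
lemma expWorkloadStep_le {β κ z e : ℝ} (hβ : 0 < β) (hκ : 0 < κ) (hz : 0 < z) (he : 0 ≤ e) :
    expWorkloadStep β κ z e ≤ β * max z (κ / β) * Real.exp e := by
  have hβκ : κ / β * β = κ := by field_simp
  rw [expWorkloadStep, workloadStep, Real.log_inv, Real.exp_monotone.map_max, Real.exp_zero,
    mul_max_of_nonneg _ _ hκ.le, mul_one]
  refine max_le ?_ ?_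
  · rw [sub_neg_eq_add, Real.exp_add, Real.exp_add, Real.exp_log (by positivity), Real.exp_log hβ]
    have : κ * (z / κ * Real.exp e * β) = β * z * Real.exp e := by field_simp
    rw [this]
    gcongr
    exact le_max_left _ _
  · have h1 : κ ≤ β * max z (κ / β) := by
      calc κ = β * (κ / β) := by rw [mul_comm, hβκ]
        _ ≤ _ := by gcongr; exact le_max_right _ _
    nlinarith [Real.one_le_exp he]

variable {β κ : ℝ}

lemma level_pos (hκ : 0 < κ) (z : Level κ) : 0 < (z : ℝ) :=
  (lt_min one_pos hκ).trans_le z.2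

lemma lintegral_expWorkloadKernel (hκ : 0 < κ) (z : Level κ) {f : Level κ → ℝ≥0∞}
    (hf : Measurable f) :
    ∫⁻ y, f y ∂expWorkloadKernel β hκ z = ∫⁻ e, f (levelStep β hκ (z, e)) ∂expMeasure 1 := by
  have h := hf.comp (measurable_levelStep β hκ)
  rw [expWorkloadKernel, Kernel.lintegral_map _ (measurable_levelStep β hκ) _ hf]
  refine (Kernel.lintegral_id_prod h _ _).trans ?_
  rw [Kernel.const_apply]
  rfl

lemma ae_le_expWorkloadKernel (hκ : 0 < κ) (z : Level κ) :
    ∀ᵐ y : Level κ ∂expWorkloadKernel β hκ z, κ ≤ (y : ℝ) := by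
  have hs : MeasurableSet {y : Level κ | ¬ κ ≤ (y : ℝ)} :=
    (measurableSet_le measurable_const measurable_subtype_coe).compl
  rw [ae_iff, ← lintegral_indicator_one hs,
    lintegral_expWorkloadKernel hκ z (measurable_one.indicator hs)]
  refine (lintegral_congr fun e => ?_).trans lintegral_zero
  simp [levelStep, le_expWorkloadStep, hκ]

/-- The drift condition for `z ^ α`. -/
lemma lintegral_rpow_expWorkloadKernel_le (hβ : 0 < β) (hκ : 0 < κ) {α : ℝ} (hα0 : 0 ≤ α)
    (hα1 : α < 1) (z : Level κ) :
    ∫⁻ y : Level κ, ENNReal.ofReal ((y : ℝ) ^ α) ∂expWorkloadKernel β hκ z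
      ≤ ENNReal.ofReal (max (z : ℝ) (κ / β) ^ α / ((1 - α) * β ^ (-α))) := by
  have hz := level_pos hκ z
  rw [lintegral_expWorkloadKernel hκ z (by fun_prop)]
  calc _ ≤ ∫⁻ e, ENNReal.ofReal ((β * max (z : ℝ) (κ / β)) ^ α)
          * ENNReal.ofReal (Real.exp (α * e)) ∂expMeasure 1 := by
        refine lintegral_mono_ae ?_
        filter_upwards [ae_nonneg_expMeasure] with e he
        rw [← ENNReal.ofReal_mul (by positivity)]
        refine ENNReal.ofReal_le_ofReal ?_
        rw [mul_comm α, Real.exp_mul, ← Real.mul_rpow (by positivity) (by positivity)]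
        exact Real.rpow_le_rpow (hκ.le.trans (le_expWorkloadStep β hκ _ _))
          (expWorkloadStep_le hβ hκ hz he) hα0
    _ = _ := by
        rw [lintegral_const_mul _ (by fun_prop), lintegral_exp_mul_expMeasure hα1,
          ← ENNReal.ofReal_mul (by positivity)]
        congr 1
        rw [Real.mul_rpow hβ.le (by positivity), Real.rpow_neg hβ.le]
        have : 0 < β ^ α := by positivity
        have : 0 < 1 - α := by linarith
        field_simp

variable {n : Level κ → ℕ}

lemma lintegral_dominatingKernel_of_two_le (hκ : 0 < κ) (hm : Measurable n) (hn : ∀ z, 1 ≤ n z)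
    {x : State n} (hx : 2 ≤ x.1.2) {f : State n → ℝ≥0∞} (hf : Measurable f) :
    ∫⁻ y, f y ∂dominatingKernel β hκ hm hn x = f (countDown x) := by
  rw [dominatingKernel, Kernel.lintegral_piecewise, if_pos (show x ∈ {x : State n | 2 ≤ x.1.2} from hx),
    Kernel.lintegral_deterministic' _ hf]

lemma lintegral_dominatingKernel_of_lt_two (hκ : 0 < κ) (hm : Measurable n) (hn : ∀ z, 1 ≤ n z)
    {x : State n} (hx : ¬ 2 ≤ x.1.2) {f : State n → ℝ≥0∞} (hf : Measurable f) :
    ∫⁻ y, f y ∂dominatingKernel β hκ hm hn x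
      = ∫⁻ z, f (refill hn z) ∂expWorkloadKernel β hκ x.1.1 := by
  rw [dominatingKernel, Kernel.lintegral_piecewise, if_neg (show x ∉ {x : State n | 2 ≤ x.1.2} from hx),
    Kernel.lintegral_comap, Kernel.lintegral_map _ (measurable_refill hn hm) _ hf]

lemma measurableSet_returnSet : MeasurableSet (returnSet β n) :=
  measurableSet_Icc.preimage
    (measurable_subtype_coe.comp (measurable_fst.comp measurable_subtype_coe))

/-- `F t z` bounds the moment when `t` steps have passed or are certain to pass before the next
jump, which is from `z`; `B t z` bounds it just after a jump to `z` at time `t`. -/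
theorem exists_returnMoment_le (hκ : 0 < κ) (hm : Measurable n) (hn : ∀ z, 1 ≤ n z)
    (hloc : ∀ T : ℝ, ∃ B : ℕ, ∀ z : Level κ, (z : ℝ) ≤ T → n z ≤ B)
    {R : ℕ → ℝ} {F B : ℕ → ℝ → ℝ} {C α : ℝ}
    (hR : Tendsto R atTop atTop) (hRmono : Monotone R)
    (hFmeas : ∀ t, Measurable (F t)) (hFmono : ∀ z, κ / β ≤ z → Monotone fun t => F t z)
    (hRF : ∀ t z, κ / β ≤ z → R t ≤ F t z)
    (hRB : ∀ t z, κ ≤ z → z ≤ κ / β → R t ≤ B t z)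
    (hFB : ∀ t (z : Level κ), κ / β < z → F (t + n z) z ≤ B t z)
    (hBF : ∀ t (z : Level κ), ∫⁻ y : Level κ, ENNReal.ofReal (B t y) ∂expWorkloadKernel β hκ z
      ≤ ENNReal.ofReal (F t (max z (κ / β))))
    (hα : 0 ≤ α) (hB : ∀ z : ℝ, κ / β < z → B 0 z ≤ C * z ^ α) :
    ∃ C : ℝ, ∀ x : State n, returnMoment β hκ hm hn R x ≤ ENNReal.ofReal (C * (x.1.1 : ℝ) ^ α) := by
  classical
  -- From `(z, m)` at time `t` the next jump lands at time `t + m`. Levels below `κ / β` are lifted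
  -- to it, as in the drift bound; this also covers levels below `κ`, which lie outside the return
  -- set.
  set W : ℕ → State n → ℝ≥0∞ := fun t x =>
    ENNReal.ofReal (F (t + x.1.2) (max (x.1.1 : ℝ) (κ / β))) with hW
  have hWmeas : ∀ t, Measurable (W t) := by
    intro t
    have h2 : Measurable fun p : ℕ × ℝ => ENNReal.ofReal (F (t + p.1) p.2) :=
      measurable_from_prod_countable_right fun m => (hFmeas (t + m)).ennreal_ofReal
    have h3 : Measurable fun x : State n => (x.1.2, max (x.1.1 : ℝ) (κ / β)) := by fun_prop
    exact h2.comp h3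
  have hdrift : ∀ t x, ∫⁻ y, (if y ∈ returnSet β n then ENNReal.ofReal (R (t + 1))
      else W (t + 1) y) ∂dominatingKernel β hκ hm hn x ≤ W t x := by
    intro t x
    have hmeas : Measurable fun y => if y ∈ returnSet β n then ENNReal.ofReal (R (t + 1))
      else W (t + 1) y := Measurable.ite measurableSet_returnSet measurable_const (hWmeas _)
    by_cases hx : 2 ≤ x.1.2
    · rw [lintegral_dominatingKernel_of_two_le hκ hm hn hx hmeas]
      split_ifs
      · exact ENNReal.ofReal_le_ofReal ((hRmono (by omega)).trans (hRF _ _ (le_max_right _ _)))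
      · refine le_of_eq ?_
        have : t + 1 + max (x.1.2 - 1) 1 = t + x.1.2 := by omega
        simp only [hW, countDown, this]
    · rw [lintegral_dominatingKernel_of_lt_two hκ hm hn hx hmeas]
      have hx1 : x.1.2 = 1 := by have := x.2.1; omega
      simp only [hW, hx1]
      refine le_trans (lintegral_mono_ae ?_) (hBF (t + 1) x.1.1)
      filter_upwards [ae_le_expWorkloadKernel hκ x.1.1] with y hy
      by_cases hyβ : (y : ℝ) ≤ κ / β
      · rw [if_pos (show refill hn y ∈ returnSet β n from ⟨hy, hyβ⟩)]
        exact ENNReal.ofReal_le_ofReal (hRB _ _ hy hyβ)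
      · rw [if_neg (fun h : refill hn y ∈ returnSet β n => hyβ h.2)]
        push Not at hyβ
        simp only [refill, max_eq_left hyβ.le]
        exact ENNReal.ofReal_le_ofReal (hFB _ _ hyβ)
  have hmain : ∀ x, returnMoment β hκ hm hn R x ≤ W 0 x :=
    lintegral_extendRate_returnTime_le _ measurableSet_returnSet hR hWmeas
      (fun t y => ENNReal.ofReal_le_ofReal
        ((hRmono (Nat.le_add_right _ _)).trans (hRF _ _ (le_max_right _ _)))) hdrift
  obtain ⟨N, hN⟩ := hloc (κ / β)
  have hmin : 0 < min 1 κ := lt_min one_pos hκ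
  -- The second constant serves levels up to `κ / β`, where the delay is at most `N` and `z ^ α` is
  -- at least `(min 1 κ) ^ α`.
  refine ⟨max C (|F N (κ / β)| / (min 1 κ) ^ α), fun x => (hmain x).trans
    (ENNReal.ofReal_le_ofReal ?_)⟩
  have hz := level_pos hκ x.1.1
  simp only [zero_add]
  by_cases hx : (x.1.1 : ℝ) ≤ κ / β
  · rw [max_eq_right hx]
    calc F x.1.2 (κ / β) ≤ F N (κ / β) := hFmono _ le_rfl (x.2.2.trans (hN _ hx))
      _ ≤ |F N (κ / β)| / (min 1 κ) ^ α * (min 1 κ) ^ α := by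
        rw [div_mul_cancel₀ _ (by positivity)]
        exact le_abs_self _
      _ ≤ _ := by
        gcongr
        · exact le_max_right _ _
        · exact x.1.1.2
  · push Not at hx
    rw [max_eq_left hx.le]
    calc F x.1.2 x.1.1 ≤ F (0 + n x.1.1) x.1.1 := hFmono _ hx.le (by rw [zero_add]; exact x.2.2)
      _ ≤ _ := hFB 0 _ hx
      _ ≤ _ := hB _ hx
      _ ≤ _ := by gcongr; exact le_max_left _ _

end

/-! ### The root `αβ`; geometric and polynomial moments -/

section

/-- Up to sign this is the secant slope of the strictly concave `log` between `1 - a` and `1`. -/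
lemma strictAntiOn_log_one_sub_div :
    StrictAntiOn (fun a : ℝ => Real.log (1 - a) / a) (Set.Ioo 0 1) := by
  intro a ha b hb hab
  have h := strictConcaveOn_log_Ioi.secant_strict_mono (a := 1) (x := 1 - b) (y := 1 - a)
    (by simp) (by simpa using hb.2) (by simpa using ha.2) (by linarith [hb.1]) (by linarith [ha.1])
    (by linarith)
  simp only [Real.log_one, sub_zero, sub_sub_cancel_left, div_neg] at h
  exact neg_lt_neg_iff.1 h

lemma exists_log_eq_log_one_sub_div {β : ℝ} (hβ0 : 0 < β) (hβ1 : β < Real.exp (-1)) :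
    ∃ a ∈ Set.Ioo (0 : ℝ) 1, Real.log β = Real.log (1 - a) / a := by
  have hL : 1 < -Real.log β := by
    have := Real.log_lt_log hβ0 hβ1
    rw [Real.log_exp] at this
    linarith
  set L := -Real.log β with hLdef
  have hβ1' : β < 1 := hβ1.trans (by simp)
  -- Intermediate values between `1 - β` and `a₁`. At `1 - β` the value `log β / (1 - β)` is below
  -- `log β`, since `log β < 0`. At `a₁`, `log x ≥ 1 - 1 / x` gives `log (1 - a₁) ≥ (1 - L) / 2 ≥ -L
  -- * a₁`.
  set a₁ := 1 - 2 / (1 + L) with ha₁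
  have hlt : 2 / (1 + L) < 1 := by rw [div_lt_one (by linarith)]; linarith
  have hpos : 0 < 2 / (1 + L) := by positivity
  have h1 : a₁ ∈ Set.Ioo (0 : ℝ) 1 := ⟨by linarith, by linarith⟩
  have h2 : 1 - β ∈ Set.Ioo (0 : ℝ) 1 := ⟨by linarith, by linarith⟩
  have hcont : ContinuousOn (fun a : ℝ => Real.log (1 - a) / a) (Set.Ioo 0 1) := by
    refine ContinuousOn.div (ContinuousOn.log (by fun_prop) ?_) (by fun_prop) ?_
    · intro a ha; linarith [ha.2]
    · intro a ha; exact ha.1.ne'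
  have h := (isPreconnected_Ioo (a := (0 : ℝ)) (b := 1)).intermediate_value h2 h1 hcont
  suffices hmem : Real.log β ∈ Set.Icc (Real.log (1 - (1 - β)) / (1 - β))
      (Real.log (1 - a₁) / a₁) by
    obtain ⟨a, ha, hae⟩ := h hmem
    exact ⟨a, ha, hae.symm⟩
  constructor
  · simp only [sub_sub_cancel]
    rw [div_le_iff₀ h2.1]
    nlinarith
  · have h3 := Real.one_sub_inv_le_log_of_pos hpos
    simp only [ha₁, sub_sub_cancel]
    rw [← ha₁, le_div_iff₀ h1.1]
    refine le_trans ?_ h3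
    rw [ha₁, inv_div, show Real.log β = -L by simp [hLdef]]
    have : 1 + L ≠ 0 := by linarith
    rw [← sub_nonneg]
    have : 1 - (1 + L) / 2 - -L * (1 - 2 / (1 + L)) = (L - 1) ^ 2 / (2 * (1 + L)) := by
      field_simp
      ring
    rw [this]
    positivity

lemma one_lt_of_lt_root {β αβ α : ℝ} (hβ0 : 0 < β) (hαβ : αβ ∈ Set.Ioo (0 : ℝ) 1)
    (h : Real.log β = Real.log (1 - αβ) / αβ) (hα : α ∈ Set.Ioo (0 : ℝ) αβ) :
    1 < (1 - α) * β ^ (-α) := by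
  have h1 : 0 < 1 - α := by linarith [hα.2, hαβ.2]
  have h2 := strictAntiOn_log_one_sub_div ⟨hα.1, hα.2.trans hαβ.2⟩ hαβ hα.2
  simp only [← h] at h2
  rw [lt_div_iff₀ hα.1] at h2
  rw [← Real.log_pos_iff (by positivity), Real.log_mul h1.ne' (by positivity), Real.log_rpow hβ0]
  linarith

variable {β κ : ℝ}

lemma lintegral_affine_rpow_expWorkloadKernel_le (hβ : 0 < β) (hκ : 0 < κ) {α : ℝ} (hα0 : 0 ≤ α)
    (hα1 : α < 1) {a b : ℝ} (ha : 0 ≤ a) (hb : 0 ≤ b) (z : Level κ) :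
    ∫⁻ y : Level κ, ENNReal.ofReal (a + b * (y : ℝ) ^ α) ∂expWorkloadKernel β hκ z
      ≤ ENNReal.ofReal (a + b * (max (z : ℝ) (κ / β) ^ α / ((1 - α) * β ^ (-α)))) := by
  have h1 : 0 < 1 - α := by linarith
  have hz := level_pos hκ z
  calc _ = ∫⁻ y : Level κ, (ENNReal.ofReal a + ENNReal.ofReal b * ENNReal.ofReal ((y : ℝ) ^ α))
        ∂expWorkloadKernel β hκ z := by
        refine lintegral_congr fun y => ?_
        have := level_pos hκ y
        rw [← ENNReal.ofReal_mul hb, ← ENNReal.ofReal_add ha (by positivity)]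
    _ = ENNReal.ofReal a + ENNReal.ofReal b *
        ∫⁻ y : Level κ, ENNReal.ofReal ((y : ℝ) ^ α) ∂expWorkloadKernel β hκ z := by
        rw [lintegral_add_left measurable_const, lintegral_const, measure_univ, mul_one,
          lintegral_const_mul _ (by fun_prop)]
    _ ≤ _ := by
        rw [ENNReal.ofReal_add ha (by positivity), ENNReal.ofReal_mul hb]
        gcongr
        exact lintegral_rpow_expWorkloadKernel_le hβ hκ hα0 hα1 z

variable {n : Level κ → ℕ} {α : ℝ}

/-- A delay of at most `N` steps costs at most one factor `ρ` in `ρ ^ (t / N)`, which is what a jump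
gains. -/
theorem exists_geometric_moment_le (hβ0 : 0 < β) (hβ1 : β < 1) (hκ : 0 < κ) (hm : Measurable n)
    (hn : ∀ z, 1 ≤ n z)
    (hloc : ∀ T : ℝ, ∃ B : ℕ, ∀ z : Level κ, (z : ℝ) ≤ T → n z ≤ B)
    (hα0 : 0 < α) (hα1 : α < 1) (hρ : 1 < (1 - α) * β ^ (-α)) {N : ℕ} (hN0 : 0 < N)
    (hN : ∀ z : Level κ, κ / β < z → n z ≤ N) :
    ∃ C : ℝ, ∀ x : State n,
      returnMoment β hκ hm hn (fun t => ((1 - α) * β ^ (-α)) ^ ((t : ℝ) / N)) x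
        ≤ ENNReal.ofReal (C * (x.1.1 : ℝ) ^ α) := by
  set ρ := (1 - α) * β ^ (-α) with hρdef
  have hρ0 : 0 < ρ := by linarith
  have hN' : (0 : ℝ) < N := by exact_mod_cast hN0
  have hmono : Monotone fun t : ℕ => ρ ^ ((t : ℝ) / N) := fun s t hst =>
    Real.rpow_le_rpow_of_exponent_le hρ.le (by gcongr)
  have hκβ : κ ≤ κ / β := by rw [le_div_iff₀ hβ0]; nlinarith
  refine exists_returnMoment_le hκ hm hn hloc (C := ρ / κ ^ α)
    (F := fun t z => ρ ^ ((t : ℝ) / N) * (z / κ) ^ α)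
    (B := fun t z => ρ ^ ((t : ℝ) / N) * (ρ / κ ^ α * z ^ α))
    ?_ hmono (fun t => by fun_prop) ?_ ?_ ?_ ?_ ?_ hα0.le ?_
  · exact (tendsto_rpow_atTop_of_base_gt_one ρ hρ).comp
      (tendsto_natCast_atTop_atTop.atTop_div_const hN')
  · intro z hz s t hst
    have : 0 ≤ z / κ := div_nonneg (hκ.le.trans (hκβ.trans hz)) hκ.le
    exact mul_le_mul_of_nonneg_right (hmono hst) (by positivity)
  · intro t z hz
    refine le_mul_of_one_le_right (by positivity) (Real.one_le_rpow ?_ hα0.le)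
    rw [le_div_iff₀ hκ]
    linarith
  · intro t z hz _
    have hz0 := hκ.trans_le hz
    refine le_mul_of_one_le_right (by positivity) ?_
    rw [div_mul_eq_mul_div, one_le_div (by positivity)]
    nlinarith [Real.rpow_le_rpow hκ.le hz hα0.le, Real.rpow_pos_of_pos hκ α]
  · intro t z hz
    have hz0 := level_pos hκ z
    have h1 : ρ ^ (((t + n z : ℕ) : ℝ) / N) ≤ ρ ^ ((t : ℝ) / N) * ρ := by
      calc _ ≤ ρ ^ ((t : ℝ) / N + 1) := by
            refine Real.rpow_le_rpow_of_exponent_le hρ.le ?_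
            rw [Nat.cast_add, add_div]
            gcongr
            rw [div_le_one hN']
            exact_mod_cast hN z hz
        _ = _ := by rw [Real.rpow_add hρ0, Real.rpow_one]
    calc _ ≤ ρ ^ ((t : ℝ) / N) * ρ * ((z : ℝ) / κ) ^ α := by gcongr
      _ = _ := by rw [Real.div_rpow hz0.le hκ.le]; ring
  · intro t z
    have h := lintegral_affine_rpow_expWorkloadKernel_le hβ0 hκ hα0.le hα1 le_rfl
      (show 0 ≤ ρ ^ ((t : ℝ) / N) * (ρ / κ ^ α) by positivity) z
    simp only [zero_add, mul_assoc] at h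
    refine h.trans (le_of_eq ?_)
    have hz := level_pos hκ z
    rw [← hρdef, Real.div_rpow (by positivity) hκ.le]
    congr 2
    field_simp
  · intro z hz
    simp

lemma eventually_le_mul_of_isEquivalent {ι : Type*} {l : Filter ι} {u v : ι → ℝ} (h : u ~[l] v)
    (hv : ∀ᶠ i in l, 0 ≤ v i) {θ : ℝ} (hθ : 1 < θ) : ∀ᶠ i in l, u i ≤ θ * v i := by
  filter_upwards [h.isLittleO.bound (sub_pos.2 hθ), hv] with i hi hvi
  simp only [Pi.sub_apply, Real.norm_eq_abs, abs_of_nonneg hvi] at hi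
  linarith [le_abs_self (u i - v i)]

lemma exists_delay_le_mul_rpow (hκ : 0 < κ)
    (hloc : ∀ T : ℝ, ∃ B : ℕ, ∀ z : Level κ, (z : ℝ) ≤ T → n z ≤ B) {γ γ' : ℝ}
    (hγ : (fun z => (n z : ℝ)) ~[atTop] (fun z : Level κ => (z : ℝ) ^ γ)) (hγγ' : γ ≤ γ')
    (hγ' : 0 ≤ γ') : ∃ b : ℝ, 0 < b ∧ ∀ z : Level κ, (n z : ℝ) ≤ b * (z : ℝ) ^ γ' := by
  have h := eventually_le_mul_of_isEquivalent hγ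
    (Eventually.of_forall fun z => by have := level_pos hκ z; positivity) one_lt_two
  obtain ⟨z₀, hz₀⟩ := eventually_atTop.1 h
  obtain ⟨N, hN⟩ := hloc (max (z₀ : ℝ) 1)
  have hmin : 0 < min 1 κ := lt_min one_pos hκ
  refine ⟨2 + N / (min 1 κ) ^ γ', by positivity, fun z => ?_⟩
  have hz := level_pos hκ z
  rw [add_mul]
  by_cases hzz : (z : ℝ) ≤ max (z₀ : ℝ) 1
  · calc (n z : ℝ) ≤ N := by exact_mod_cast hN z hzz
      _ = N / (min 1 κ) ^ γ' * (min 1 κ) ^ γ' := by field_simp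
      _ ≤ N / (min 1 κ) ^ γ' * (z : ℝ) ^ γ' := by gcongr; exact z.2
      _ ≤ _ := le_add_of_nonneg_left (by positivity)
  · push Not at hzz
    calc (n z : ℝ) ≤ 2 * (z : ℝ) ^ γ := hz₀ z (Subtype.coe_le_coe.1 ((le_max_left (z₀ : ℝ) 1).trans hzz.le))
      _ ≤ 2 * (z : ℝ) ^ γ' := by
        gcongr
        exact (le_max_right _ _).trans hzz.le
      _ ≤ _ := le_add_of_nonneg_right (by positivity)

lemma tendsto_natCast_rpow {p : ℝ} (hp : 0 < p) :
    Tendsto (fun t : ℕ => (t : ℝ) ^ p) atTop atTop :=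
  (tendsto_rpow_atTop hp).comp tendsto_natCast_atTop_atTop

lemma monotone_natCast_rpow {p : ℝ} (hp : 0 ≤ p) : Monotone fun t : ℕ => (t : ℝ) ^ p :=
  fun s t hst => Real.rpow_le_rpow (by positivity) (by exact_mod_cast hst) hp

/-- Polynomial moments of order at most one. -/
theorem exists_concave_moment_le (hβ0 : 0 < β) (hκ : 0 < κ) (hm : Measurable n)
    (hn : ∀ z, 1 ≤ n z)
    (hloc : ∀ T : ℝ, ∃ B : ℕ, ∀ z : Level κ, (z : ℝ) ≤ T → n z ≤ B)
    (hα0 : 0 < α) (hα1 : α < 1) (hρ : 1 < (1 - α) * β ^ (-α)) {p b : ℝ} (hp0 : 0 < p)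
    (hp1 : p ≤ 1) (hb0 : 0 < b) (hb : ∀ z : Level κ, (n z : ℝ) ^ p ≤ b * (z : ℝ) ^ α) :
    ∃ C : ℝ, ∀ x : State n, returnMoment β hκ hm hn (fun t => (t : ℝ) ^ p) x
        ≤ ENNReal.ofReal (C * (x.1.1 : ℝ) ^ α) := by
  set ρ := (1 - α) * β ^ (-α) with hρdef
  have hρ0 : 0 < ρ - 1 := by linarith
  have hρ1 : 0 < ρ := by linarith
  have hmono := monotone_natCast_rpow hp0.le
  -- Solves `b + a = a * ρ`: the delay cost `b * z ^ α` on top of `a * z ^ α` is exactly what the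
  -- jump absorbs.
  set a := b / (ρ - 1) with ha
  have ha0 : 0 < a := by positivity
  have hab : b + a = a * ρ := by rw [ha]; field_simp; ring
  have hκβ : 0 < κ / β := by positivity
  refine exists_returnMoment_le hκ hm hn hloc (C := a * ρ)
    (F := fun t z => (t : ℝ) ^ p + a * z ^ α) (B := fun t z => (t : ℝ) ^ p + a * ρ * z ^ α)
    (tendsto_natCast_rpow hp0) hmono (fun t => by fun_prop) ?_ ?_ ?_ ?_ ?_ hα0.le ?_
  · exact fun z _ s t hst => add_le_add_left (hmono hst) _
  · intro t z hz
    have := hκβ.trans_le hz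
    exact le_add_of_nonneg_right (by positivity)
  · intro t z hz _
    have := hκ.trans_le hz
    exact le_add_of_nonneg_right (by positivity)
  · intro t z _
    -- Subadditivity of `t ^ p` for `p ≤ 1` separates the delay from the elapsed time.
    have := Real.rpow_add_le_add_rpow (Nat.cast_nonneg t) (Nat.cast_nonneg (n z)) hp0.le hp1
    rw [Nat.cast_add, ← hab, add_mul]
    linarith [hb z]
  · intro t z
    refine (lintegral_affine_rpow_expWorkloadKernel_le hβ0 hκ hα0.le hα1
      (by positivity) (by positivity) z).trans (le_of_eq ?_)
    rw [← hρdef]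
    congr 2
    field_simp
  · intro z _
    simp [Real.zero_rpow hp0.ne']

/-- Polynomial moments of order at least one. -/
theorem exists_convex_moment_le (hβ0 : 0 < β) (hκ : 0 < κ) (hm : Measurable n)
    (hn : ∀ z, 1 ≤ n z)
    (hloc : ∀ T : ℝ, ∃ B : ℕ, ∀ z : Level κ, (z : ℝ) ≤ T → n z ≤ B)
    (hα0 : 0 < α) (hα1 : α < 1) (hρ : 1 < (1 - α) * β ^ (-α)) {η b : ℝ} (hη0 : 0 < η)
    (hη1 : η ≤ 1) (hb0 : 0 < b) (hb : ∀ z : Level κ, (n z : ℝ) ≤ b * (z : ℝ) ^ (α * η)) :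
    ∃ C : ℝ, ∀ x : State n, returnMoment β hκ hm hn (fun t => (t : ℝ) ^ (1 / η)) x
        ≤ ENNReal.ofReal (C * (x.1.1 : ℝ) ^ α) := by
  set ρ := (1 - α) * β ^ (-α) with hρdef
  have hρ1 : 0 < ρ := by linarith
  have hρη : 1 < ρ ^ η := Real.one_lt_rpow hρ hη0
  have hρ0 : 0 < ρ ^ η - 1 := by linarith
  have hp0 : 0 < 1 / η := by positivity
  have hp1 : 1 ≤ 1 / η := by rwa [one_le_div hη0]
  have hmono := monotone_natCast_rpow hp0.le
  have hpow : ∀ z : ℝ, 0 ≤ z → (z ^ (α * η)) ^ (1 / η) = z ^ α := fun z hz => by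
    rw [← Real.rpow_mul hz, mul_assoc, mul_one_div_cancel hη0.ne', mul_one]
  -- As `z ^ (α * η)` contracts by `ρ ^ η` in `L^(1/η)`, the balance is now `b + a = a * ρ ^ η`.
  set a := b / (ρ ^ η - 1) with ha
  have ha0 : 0 < a := by positivity
  have hab : b + a = a * ρ ^ η := by rw [ha]; field_simp; ring
  have hκβ : 0 < κ / β := by positivity
  refine exists_returnMoment_le hκ hm hn hloc (C := (a * ρ ^ η) ^ (1 / η))
    (F := fun t z => ((t : ℝ) + a * z ^ (α * η)) ^ (1 / η))
    (B := fun t z => ((t : ℝ) + a * ρ ^ η * z ^ (α * η)) ^ (1 / η))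
    (tendsto_natCast_rpow hp0) hmono (fun t => by fun_prop) ?_ ?_ ?_ ?_ ?_ hα0.le ?_
  · intro z hz s t hst
    have := hκβ.trans_le hz
    have hst' : (s : ℝ) ≤ t := by exact_mod_cast hst
    show ((s : ℝ) + _) ^ _ ≤ ((t : ℝ) + _) ^ _
    gcongr
  · intro t z hz
    have := hκβ.trans_le hz
    refine Real.rpow_le_rpow (by positivity) (le_add_of_nonneg_right (by positivity)) hp0.le
  · intro t z hz _
    have := hκ.trans_le hz
    refine Real.rpow_le_rpow (by positivity) (le_add_of_nonneg_right (by positivity)) hp0.le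
  · intro t z _
    have := level_pos hκ z
    refine Real.rpow_le_rpow (by positivity) ?_ hp0.le
    rw [Nat.cast_add, ← hab, add_mul]
    linarith [hb z]
  · intro t z
    have hz := level_pos hκ z
    set c := a * ρ ^ η with hc
    have hc0 : 0 < c := by positivity
    set zt := max (z : ℝ) (κ / β) with hzt
    have hzt0 : 0 < zt := hz.trans_le (le_max_left _ _)
    have h1 : ∀ y : Level κ, ENNReal.ofReal (((t : ℝ) + c * (y : ℝ) ^ (α * η)) ^ (1 / η))
        = ((fun _ : Level κ => ENNReal.ofReal (t : ℝ)) + fun y : Level κ =>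
          ENNReal.ofReal (c * (y : ℝ) ^ (α * η)) : Level κ → ℝ≥0∞) y ^ (1 / η) := by
      intro y
      have := level_pos hκ y
      rw [Pi.add_apply, ← ENNReal.ofReal_add (by positivity) (by positivity),
        ENNReal.ofReal_rpow_of_nonneg (by positivity) hp0.le]
    have h2 : ∀ y : Level κ, ENNReal.ofReal (c * (y : ℝ) ^ (α * η)) ^ (1 / η)
        = ENNReal.ofReal (0 + c ^ (1 / η) * (y : ℝ) ^ α) := by
      intro y
      have := level_pos hκ y
      rw [ENNReal.ofReal_rpow_of_nonneg (by positivity) hp0.le,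
        Real.mul_rpow (by positivity) (by positivity), hpow _ this.le, zero_add]
    -- Minkowski in `L^(1/η)`: the deterministic time `t` passes through unchanged, and only the
    -- level part contracts.
    have h3 := ENNReal.lintegral_Lp_add_le (μ := expWorkloadKernel β hκ z)
      (f := fun _ => ENNReal.ofReal t)
      (g := fun y : Level κ => ENNReal.ofReal (c * (y : ℝ) ^ (α * η)))
      (by fun_prop) (by fun_prop) hp1
    simp only [h2, lintegral_const, measure_univ, mul_one, one_div_one_div] at h3
    rw [← ENNReal.rpow_mul, one_div_mul_cancel hη0.ne', ENNReal.rpow_one] at h3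
    have h4 := lintegral_affine_rpow_expWorkloadKernel_le hβ0 hκ hα0.le hα1 le_rfl
      (show 0 ≤ c ^ (1 / η) by positivity) z
    have h5 : ENNReal.ofReal (0 + c ^ (1 / η) * (zt ^ α / ρ)) ^ η
        = ENNReal.ofReal (a * zt ^ (α * η)) := by
      rw [ENNReal.ofReal_rpow_of_nonneg (by positivity) hη0.le, zero_add,
        Real.mul_rpow (by positivity) (by positivity), ← Real.rpow_mul (by positivity),
        one_div_mul_cancel hη0.ne', Real.rpow_one, Real.div_rpow (by positivity) hρ1.le,
        ← Real.rpow_mul (by positivity), hc]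
      congr 1
      field_simp
    have h6 := h3.trans (add_le_add le_rfl (ENNReal.rpow_le_rpow h4 hη0.le))
    rw [h5, ← ENNReal.ofReal_add (by positivity) (by positivity)] at h6
    have h7 := ENNReal.rpow_le_rpow h6 hp0.le
    rw [← ENNReal.rpow_mul, mul_one_div_cancel hη0.ne', ENNReal.rpow_one,
      ENNReal.ofReal_rpow_of_nonneg (by positivity) hp0.le] at h7
    rw [lintegral_congr h1]
    exact h7
  · intro z hz
    have := hκβ.trans hz
    rw [Nat.cast_zero, zero_add, Real.mul_rpow (by positivity) (by positivity), hpow _ this.le]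

end

/-! ### Subexponential moments -/

section

/-- The `ℓ^q` sum of `A ^ (1 / q)` and `x`. -/
def powerSum (q A x : ℝ) : ℝ := (A + x ^ q) ^ (1 / q)

section PowerSum

variable {q A x : ℝ}

lemma powerSum_zero (hq : 1 ≤ q) (hx : 0 ≤ x) : powerSum q 0 x = x := by
  rw [powerSum, zero_add, ← Real.rpow_mul hx, mul_one_div_cancel (by linarith), Real.rpow_one]

lemma powerSum_mono (hq : 1 ≤ q) {A' x' : ℝ} (hA : 0 ≤ A) (hx : 0 ≤ x)
    (h : A + x ^ q ≤ A' + x' ^ q) : powerSum q A x ≤ powerSum q A' x' := by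
  have : 0 ≤ x ^ q := by positivity
  exact Real.rpow_le_rpow (by positivity) h (by positivity)

lemma le_powerSum (hq : 1 ≤ q) (hA : 0 ≤ A) (hx : 0 ≤ x) : x ≤ powerSum q A x := by
  have := powerSum_mono hq (A := 0) (x := x) (A' := A) (x' := x) le_rfl hx (by linarith)
  rwa [powerSum_zero hq hx] at this

lemma hasDerivAt_powerSum (hq : 1 ≤ q) (hA : 0 ≤ A) (hx : 0 < x) :
    HasDerivAt (powerSum q A) ((x / powerSum q A x) ^ (q - 1)) x := by
  have hS : 0 < A + x ^ q := by positivity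
  have h := ((Real.hasDerivAt_rpow_const (x := x) (p := q) (Or.inl hx.ne')).const_add A).rpow_const
    (p := 1 / q) (Or.inl hS.ne')
  convert! h using 1
  rw [powerSum, Real.div_rpow hx.le (by positivity), ← Real.rpow_mul hS.le, div_eq_mul_inv,
    ← Real.rpow_neg hS.le]
  have e : -(1 / q * (q - 1)) = 1 / q - 1 := by field_simp; ring
  rw [e]
  field_simp

/-- Up to a constant factor, the derivative of `exp (powerSum q A (log v))` at `v = exp x`. -/
def profileSlope (q A x : ℝ) : ℝ :=
  Real.exp (powerSum q A x - x) * (x / powerSum q A x) ^ (q - 1)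

/-- The left side is the derivative of `log (profileSlope q A x)`. With `θ = x / powerSum q A x ≤
1`, Bernoulli for the exponent `(q - 1) / q` gives `θ ^ (q - 1) - 1 ≤ -((q - 1) / q) * (1 - θ ^ q)`.
The remaining term is `((q - 1) / x) * (1 - θ ^ q)`, and `x ≥ q`. -/
lemma log_slope_deriv_nonpos (hq : 1 ≤ q) (hA : 0 ≤ A) (hx : q ≤ x) :
    (x / powerSum q A x) ^ (q - 1) - 1
      + (q - 1) * (x⁻¹ - (x / powerSum q A x) ^ (q - 1) / powerSum q A x) ≤ 0 := by
  have hx0 : 0 < x := by linarith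
  have hφ := le_powerSum hq hA hx0.le
  have hφ0 : 0 < powerSum q A x := by linarith
  set φ := powerSum q A x
  set θ := x / φ with hθ
  have hθ0 : 0 < θ := by positivity
  have hθ1 : θ ≤ 1 := (div_le_one hφ0).2 hφ
  have h1 : θ ^ (q - 1) / φ = θ ^ q / x := by
    rw [Real.rpow_sub_one hθ0.ne', hθ]
    field_simp
  have h2 : θ ^ (q - 1) ≤ 1 + (q - 1) / q * (θ ^ q - 1) := by
    have h := rpow_one_add_le_one_add_mul_self (s := θ ^ q - 1) (p := (q - 1) / q)
      (by linarith [Real.rpow_pos_of_pos hθ0 q]) (div_nonneg (by linarith) (by linarith))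
      ((div_le_one (by linarith)).2 (by linarith))
    rw [add_sub_cancel, ← Real.rpow_mul hθ0.le, mul_div_cancel₀ _ (by linarith)] at h
    exact h
  have h3 : 0 ≤ 1 - θ ^ q := by
    have := Real.rpow_le_one hθ0.le hθ1 (z := q) (by linarith)
    linarith
  have h4 : (q - 1) / x ≤ (q - 1) / q :=
    div_le_div_of_nonneg_left (by linarith) (by linarith) hx
  rw [h1]
  have h5 : (q - 1) * (x⁻¹ - θ ^ q / x) = (q - 1) / x * (1 - θ ^ q) := by
    field_simp
  rw [h5]
  nlinarith [mul_le_mul_of_nonneg_right h4 h3]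

lemma antitoneOn_profileSlope (hq : 1 ≤ q) (hA : 0 ≤ A) :
    AntitoneOn (profileSlope q A) (Set.Ici q) := by
  have hpos : ∀ x ∈ Set.Ici q, 0 < x := fun x hx => by
    have : q ≤ x := hx
    linarith
  have hφpos : ∀ x ∈ Set.Ici q, 0 < powerSum q A x := fun x hx =>
    (hpos x hx).trans_le (le_powerSum hq hA (hpos x hx).le)
  have hderiv : ∀ x ∈ Set.Ici q, HasDerivAt
      (fun x => powerSum q A x - x + (q - 1) * (Real.log x - Real.log (powerSum q A x)))
      ((x / powerSum q A x) ^ (q - 1) - 1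
        + (q - 1) * (x⁻¹ - (x / powerSum q A x) ^ (q - 1) / powerSum q A x)) x := fun x hx => by
    have h := hasDerivAt_powerSum hq hA (hpos x hx)
    exact (h.sub (hasDerivAt_id x)).add
      (((Real.hasDerivAt_log (hpos x hx).ne').sub (h.log (hφpos x hx).ne')).const_mul (q - 1))
  have hanti := antitoneOn_of_hasDerivWithinAt_nonpos (convex_Ici q)
    (fun x hx => (hderiv x hx).continuousAt.continuousWithinAt)
    (fun x hx => (hderiv x (interior_subset hx)).hasDerivWithinAt)
    (fun x hx => log_slope_deriv_nonpos hq hA (interior_subset hx))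
  have heq : ∀ x ∈ Set.Ici q, profileSlope q A x = Real.exp
      (powerSum q A x - x + (q - 1) * (Real.log x - Real.log (powerSum q A x))) := fun x hx => by
    rw [profileSlope, Real.exp_add, ← Real.log_div (hpos x hx).ne' (hφpos x hx).ne', mul_comm (q - 1),
      Real.exp_mul, Real.exp_log (div_pos (hpos x hx) (hφpos x hx))]
  intro x hx y hy hxy
  rw [heq x hx, heq y hy]
  exact Real.exp_le_exp.2 (hanti hx hy hxy)

/-- `v ↦ exp (powerSum q A (log v))` lies below its tangents on `[exp q, ∞)`. -/
lemma exp_powerSum_le_tangent (hq : 1 ≤ q) (hA : 0 ≤ A) (hx : q ≤ x) {y : ℝ} (hy : q ≤ y) :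
    Real.exp (powerSum q A y) ≤ Real.exp (powerSum q A x)
      + profileSlope q A x * (Real.exp y - Real.exp x) := by
  set k : ℝ → ℝ := fun y => Real.exp (powerSum q A y) - profileSlope q A x * Real.exp y with hk
  have hderiv : ∀ y, q ≤ y → HasDerivAt k
      (Real.exp y * (profileSlope q A y - profileSlope q A x)) y := fun y hy => by
    have h := (hasDerivAt_powerSum hq hA (show 0 < y by linarith)).exp.sub
      ((Real.hasDerivAt_exp y).const_mul (profileSlope q A x))
    convert! h using 1
    rw [profileSlope, mul_sub, ← mul_assoc, ← Real.exp_add, add_sub_cancel]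
    ring
  have hanti := antitoneOn_profileSlope hq hA
  have hkle : k y ≤ k x := by
    rcases le_total y x with hyx | hxy
    · refine monotoneOn_of_hasDerivWithinAt_nonneg (convex_Icc y x)
        (fun z hz => (hderiv z (hy.trans hz.1)).continuousAt.continuousWithinAt)
        (fun z hz => (hderiv z (hy.trans (interior_subset hz).1)).hasDerivWithinAt)
        (fun z hz => ?_) (Set.left_mem_Icc.2 hyx) (Set.right_mem_Icc.2 hyx) hyx
      have hz' := interior_subset hz
      exact mul_nonneg (Real.exp_pos _).le
        (sub_nonneg.2 (hanti (hy.trans hz'.1) hx hz'.2))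
    · refine antitoneOn_of_hasDerivWithinAt_nonpos (convex_Icc x y)
        (fun z hz => (hderiv z (hx.trans hz.1)).continuousAt.continuousWithinAt)
        (fun z hz => (hderiv z (hx.trans (interior_subset hz).1)).hasDerivWithinAt)
        (fun z hz => ?_) (Set.left_mem_Icc.2 hxy) (Set.right_mem_Icc.2 hxy) hxy
      have hz' := interior_subset hz
      exact mul_nonpos_of_nonneg_of_nonpos (Real.exp_pos _).le
        (sub_nonpos.2 (hanti hx (hx.trans hz'.1) hz'.1))
  simp only [hk] at hkle
  linarith

lemma profileSlope_nonneg (hq : 1 ≤ q) (hA : 0 ≤ A) (hx : 0 ≤ x) : 0 ≤ profileSlope q A x := by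
  have := hx.trans (le_powerSum hq hA hx)
  rw [profileSlope]
  positivity

/-- The tangent has a nonnegative constant term, as the affine drift bound requires. -/
lemma profileSlope_mul_exp_le (hq : 1 ≤ q) (hA : 0 ≤ A) (hx : 0 ≤ x) :
    profileSlope q A x * Real.exp x ≤ Real.exp (powerSum q A x) := by
  have h := le_powerSum hq hA hx
  rw [profileSlope, mul_right_comm, ← Real.exp_add, sub_add_cancel]
  exact mul_le_of_le_one_right (Real.exp_pos _).le (Real.rpow_le_one
    (div_nonneg hx (hx.trans h)) (div_le_one_of_le₀ h (hx.trans h)) (by linarith))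

/-- Bernoulli's inequality, homogeneous form. -/
lemma rpow_add_mul_le_add_rpow (hq : 1 ≤ q) (hx : 0 < x) {δ : ℝ} (hδ : 0 ≤ δ) :
    x ^ q + q * δ * x ^ (q - 1) ≤ (x + δ) ^ q := by
  have h := one_add_mul_self_le_rpow_one_add (s := δ / x) (p := q)
    (by have : 0 ≤ δ / x := by positivity
        linarith) hq
  have h2 : x + δ = x * (1 + δ / x) := by field_simp
  rw [h2, Real.mul_rpow hx.le (by positivity), Real.rpow_sub_one hx.ne']
  calc _ = x ^ q * (1 + q * (δ / x)) := by field_simp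
    _ ≤ _ := by gcongr

end PowerSum

variable {β κ : ℝ} {n : Level κ → ℕ} {α : ℝ}

/-- Jensen's inequality for `exp (powerSum q A ·)`, with the drift condition. -/
lemma lintegral_exp_powerSum_le (hβ : 0 < β) (hκ : 0 < κ) (hα0 : 0 ≤ α) (hα1 : α < 1)
    {q A k : ℝ} (hq : 1 ≤ q) (hA : 0 ≤ A)
    (hk : ∀ z : Level κ, q ≤ α * Real.log z + k) (z : Level κ)
    (hkz : q ≤ α * Real.log (max (z : ℝ) (κ / β)) + k - Real.log ((1 - α) * β ^ (-α))) :
    ∫⁻ y : Level κ, ENNReal.ofReal (Real.exp (powerSum q A (α * Real.log y + k)))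
        ∂expWorkloadKernel β hκ z
      ≤ ENNReal.ofReal (Real.exp (powerSum q A
        (α * Real.log (max (z : ℝ) (κ / β)) + k - Real.log ((1 - α) * β ^ (-α))))) := by
  have h1 : 0 < 1 - α := by linarith
  have hρ : 0 < (1 - α) * β ^ (-α) := by positivity
  set ρ := (1 - α) * β ^ (-α)
  set zt := max (z : ℝ) (κ / β) with hzt
  have hzt0 : 0 < zt := (level_pos hκ z).trans_le (le_max_left _ _)
  set x := α * Real.log zt + k - Real.log ρ with hx
  have hx0 : 0 ≤ x := by linarith
  set s := profileSlope q A x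
  have hs : 0 ≤ s := profileSlope_nonneg hq hA hx0
  have hexp : ∀ y : ℝ, 0 < y → Real.exp (α * Real.log y + k) = Real.exp k * y ^ α := by
    intro y hy
    rw [Real.exp_add, Real.rpow_def_of_pos hy, mul_comm α, mul_comm]
  have hexpx : Real.exp x = Real.exp k * (zt ^ α / ρ) := by
    rw [hx, Real.exp_sub, hexp zt hzt0, Real.exp_log hρ, mul_div_assoc]
  -- The tangent is taken at `exp x`, the drift bound for the mean of `exp k * y ^ α`, so
  -- integrating it returns exactly the value at `x`.
  have hle : ∀ y : Level κ, Real.exp (powerSum q A (α * Real.log y + k))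
      ≤ (Real.exp (powerSum q A x) - s * Real.exp x) + s * Real.exp k * (y : ℝ) ^ α := by
    intro y
    have h := exp_powerSum_le_tangent hq hA hkz (hk y)
    rw [hexp y (level_pos hκ y)] at h
    linarith
  refine (lintegral_mono fun y => ENNReal.ofReal_le_ofReal (hle y)).trans ?_
  refine (lintegral_affine_rpow_expWorkloadKernel_le hβ hκ hα0 hα1
    (sub_nonneg.2 (profileSlope_mul_exp_le hq hA hx0)) (by positivity) z).trans (le_of_eq ?_)
  rw [mul_assoc, ← hexpx]
  congr 1
  ring

/-- The strict inequality `c < d * α ^ γ` absorbs the error of the asymptotics at large levels; a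
large shift `k` handles the bounded ones and keeps the argument in the range of concavity `[q, ∞)`.
-/
lemma exists_log_shift (hκ : 0 < κ)
    (hloc : ∀ T : ℝ, ∃ B : ℕ, ∀ z : Level κ, (z : ℝ) ≤ T → n z ≤ B) {γ c d q : ℝ} (hγ : 0 < γ)
    (hn : (fun z => (n z : ℝ)) ~[atTop] (fun z : Level κ => (Real.log (z : ℝ)) ^ γ))
    (hα : 0 < α) (hq : 0 ≤ q) (hc : 0 < c) (hcd : c < d * α ^ γ) :
    ∃ k : ℝ, ∀ z : Level κ, q ≤ α * Real.log z + k ∧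
      c * n z ≤ d * (α * Real.log z + k) ^ γ := by
  have hd : 0 < d := by
    have : 0 < α ^ γ := by positivity
    by_contra h
    nlinarith [not_lt.1 h]
  have hev : ∀ᶠ z : Level κ in atTop, 0 ≤ (Real.log (z : ℝ)) ^ γ := by
    have h1 : (1 : ℝ) ∈ Set.Ici (min 1 κ) := min_le_left 1 κ
    filter_upwards [eventually_ge_atTop (⟨1, h1⟩ : Level κ)] with z hz
    exact Real.rpow_nonneg (Real.log_nonneg (Subtype.coe_le_coe.2 hz)) _
  obtain ⟨z₀, hz₀⟩ := eventually_atTop.1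
    (eventually_le_mul_of_isEquivalent hn hev ((one_lt_div hc).2 hcd))
  obtain ⟨N, hN⟩ := hloc (max (z₀ : ℝ) 1)
  have hmin : 0 < min 1 κ := lt_min one_pos hκ
  set r := (c * N / d) ^ (1 / γ) with hr
  have hr0 : 0 ≤ r := by positivity
  have hlog : ∀ z : Level κ, α * Real.log (min 1 κ) ≤ α * Real.log z := fun z =>
    mul_le_mul_of_nonneg_left (Real.log_le_log hmin z.2) hα.le
  refine ⟨q + r + |α * Real.log (min 1 κ)|, fun z => ⟨?_, ?_⟩⟩
  · linarith [hlog z, neg_abs_le (α * Real.log (min 1 κ))]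
  by_cases hz : (z : ℝ) ≤ max (z₀ : ℝ) 1
  · have h1 : r ≤ α * Real.log z + (q + r + |α * Real.log (min 1 κ)|) := by
      linarith [hlog z, neg_abs_le (α * Real.log (min 1 κ))]
    calc c * n z ≤ c * N := by
          gcongr
          exact hN z hz
      _ = d * r ^ γ := by
          rw [hr, ← Real.rpow_mul (by positivity), one_div_mul_cancel hγ.ne', Real.rpow_one]
          field_simp
      _ ≤ _ := by gcongr
  · push Not at hz
    have hlz : 0 ≤ Real.log z := Real.log_nonneg ((le_max_right _ _).trans hz.le)
    have h2 := hz₀ z (Subtype.coe_le_coe.1 ((le_max_left (z₀ : ℝ) 1).trans hz.le))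
    calc c * n z ≤ c * (d * α ^ γ / c * Real.log z ^ γ) := by gcongr
      _ = d * (α * Real.log z) ^ γ := by
          rw [Real.mul_rpow hα.le hlz]
          field_simp
      _ ≤ _ := by
          gcongr
          exact le_add_of_nonneg_right (by positivity)

/-- Subexponential moments. -/
theorem exists_subexponential_moment_le (hβ0 : 0 < β) (hβ1 : β < 1) (hκ : 0 < κ) (hm : Measurable n)
    (hn : ∀ z, 1 ≤ n z)
    (hloc : ∀ T : ℝ, ∃ B : ℕ, ∀ z : Level κ, (z : ℝ) ≤ T → n z ≤ B)
    (hα0 : 0 < α) (hα1 : α < 1) (hρ : 1 < (1 - α) * β ^ (-α)) {γ η : ℝ} (hγ : 0 < γ)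
    (hnγ : (fun z => (n z : ℝ)) ~[atTop] (fun z : Level κ => (Real.log (z : ℝ)) ^ γ))
    (hη0 : 0 < η)
    (hη : η < ((1 + γ) * α⁻¹ * Real.log ((1 - α) * β ^ (-α))) ^ (1 / (1 + γ))) :
    ∃ C : ℝ, ∀ x : State n, returnMoment β hκ hm hn
        (fun t => Real.exp (η * α * (t : ℝ) ^ (1 / (1 + γ)))) x
        ≤ ENNReal.ofReal (C * (x.1.1 : ℝ) ^ α) := by
  have hL : 0 < Real.log ((1 - α) * β ^ (-α)) := Real.log_pos hρ
  set L := Real.log ((1 - α) * β ^ (-α)) with hLdef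
  set q := 1 + γ with hq
  have hq1 : 1 ≤ q := by linarith
  have hq0 : 0 < q := by linarith
  -- Makes the rate equal to `exp ((c * t) ^ (1 / q))`. The bound on `η` then becomes `c < q * L * α
  -- ^ γ`.
  set c := (η * α) ^ q with hc
  have hc0 : 0 < c := by positivity
  have hcd : c < q * L * α ^ γ := by
    have h := Real.rpow_lt_rpow hη0.le hη hq0
    rw [← Real.rpow_mul (by positivity), one_div_mul_cancel hq0.ne', Real.rpow_one] at h
    rw [hc, Real.mul_rpow hη0.le hα0.le]
    calc η ^ q * α ^ q < q * α⁻¹ * L * α ^ q := by gcongr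
      _ = q * L * α ^ γ := by
        rw [hq, Real.rpow_add hα0, Real.rpow_one]
        field_simp
  obtain ⟨k', hk'⟩ := exists_log_shift hκ hloc hγ hnγ hα0 hq0.le hc0 hcd
  -- Adding `L = log ρ` to `α * log z + k'` multiplies `z ^ α` by `ρ`.
  set k := k' + L with hk
  have hkL : ∀ y : ℝ, α * Real.log y + k - L = α * Real.log y + k' := fun y => by rw [hk]; ring
  have hκβ : 0 < κ / β := by positivity
  have hlev : ∀ z : ℝ, (∃ y : Level κ, (y : ℝ) ≤ z) → q ≤ α * Real.log z + k' := by
    rintro z ⟨y, hy⟩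
    have := Real.log_le_log (level_pos hκ y) hy
    nlinarith [(hk' y).1]
  have hκlev : ∃ y : Level κ, (y : ℝ) ≤ κ :=
    ⟨⟨κ, show min 1 κ ≤ κ from min_le_right 1 κ⟩, le_rfl⟩
  have hroot : ∀ t : ℕ, η * α * (t : ℝ) ^ (1 / q) = (c * t) ^ (1 / q) := by
    intro t
    rw [Real.mul_rpow hc0.le (by positivity), hc, ← Real.rpow_mul (by positivity),
      mul_one_div_cancel hq0.ne', Real.rpow_one]
  have hle : ∀ (t : ℕ) (x : ℝ), 0 ≤ x →
      Real.exp (η * α * (t : ℝ) ^ (1 / q)) ≤ Real.exp (powerSum q (c * t) x) := by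
    intro t x hx
    have : 0 ≤ x ^ q := by positivity
    rw [hroot]
    exact Real.exp_le_exp.2 (Real.rpow_le_rpow (by positivity) (by linarith) (by positivity))
  have hκβ' : κ ≤ κ / β := by rw [le_div_iff₀ hβ0]; nlinarith
  have hlevβ : ∀ z : ℝ, κ / β ≤ z → 0 ≤ α * Real.log z + k' := fun z hz =>
    hq0.le.trans (hlev z (hκlev.imp fun y hy => hy.trans (hκβ'.trans hz)))
  have hmonoR : Monotone fun t : ℕ => Real.exp (η * α * (t : ℝ) ^ (1 / q)) := fun s t hst =>
    Real.exp_le_exp.2 (mul_le_mul_of_nonneg_left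
      (monotone_natCast_rpow (by positivity) hst) (by positivity))
  refine exists_returnMoment_le hκ hm hn hloc (C := Real.exp k)
    (F := fun t z => Real.exp (powerSum q (c * t) (α * Real.log z + k')))
    (B := fun t z => Real.exp (powerSum q (c * t) (α * Real.log z + k)))
    ?_ hmonoR (fun t => by unfold powerSum; fun_prop) ?_ ?_ ?_ ?_ ?_ hα0.le ?_
  · exact Real.tendsto_exp_atTop.comp
      ((tendsto_natCast_rpow (by positivity)).const_mul_atTop (by positivity))
  · intro z hz s t hst
    refine Real.exp_le_exp.2 (powerSum_mono hq1 (by positivity) (hlevβ z hz) ?_)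
    have : (s : ℝ) ≤ t := by exact_mod_cast hst
    gcongr
  · exact fun t z hz => hle t _ (hlevβ z hz)
  · intro t z hz _
    refine hle t _ ?_
    have := hlev z (hκlev.imp fun y hy => hy.trans hz)
    rw [hk]
    linarith
  · intro t z _
    obtain ⟨h1, h2⟩ := hk' z
    refine Real.exp_le_exp.2 (powerSum_mono hq1 (by positivity) (by linarith) ?_)
    -- The shift by `L` raises the `q`-th power by at least `q * L * (α * log z + k') ^ γ`, which
    -- pays for the delay `c * n z`.
    have h3 := rpow_add_mul_le_add_rpow hq1 (show 0 < α * Real.log z + k' by linarith) hL.le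
    rw [hk, ← add_assoc]
    have h4 : q - 1 = γ := by rw [hq]; ring
    rw [h4] at h3
    push_cast
    linarith
  · intro t z
    have h := lintegral_exp_powerSum_le hβ0 hκ hα0.le hα1 (q := q) (A := c * t) (k := k) hq1
      (by positivity) (fun y => by rw [hk]; linarith [(hk' y).1]) z
      (by rw [← hLdef, hkL]; exact hlev _ ⟨z, le_max_left _ _⟩)
    rwa [← hLdef, hkL] at h
  · intro z hz
    have h1 := hlevβ z hz.le
    rw [Nat.cast_zero, mul_zero, powerSum_zero hq1 (by rw [hk]; linarith), Real.exp_add,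
      Real.rpow_def_of_pos (hκβ.trans hz), mul_comm α, mul_comm]

end

end TameDomination

end

/-! ### The main theorem -/

theorem mainTheorem6 (β κ : ℝ) (hβ0 : 0 < β) (hβ1 : β < Real.exp (-1)) (hκ : 0 < κ)
    (n : TameDomination.Level κ → ℕ) (hm : Measurable n) (hn : ∀ z, 1 ≤ n z)
    (hloc : ∀ T : ℝ, ∃ B : ℕ, ∀ z : TameDomination.Level κ, (z : ℝ) ≤ T → n z ≤ B) :
    ∃ αβ ∈ Set.Ioo (0 : ℝ) 1,
      Real.log β = Real.log (1 - αβ) / αβ ∧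
      (∀ a ∈ Set.Ioo (0 : ℝ) 1, Real.log β = Real.log (1 - a) / a → a = αβ) ∧
      -- polynomial moments
      (∀ γ : ℝ, 0 ≤ γ →
        (fun z => (n z : ℝ)) ~[atTop] (fun z : TameDomination.Level κ => (z : ℝ) ^ γ) →
        ∀ α ∈ Set.Ioo (0 : ℝ) αβ, ∀ η : ℝ,
          ((γ < αβ ∧ γ / α < η ∧ η ≤ 1) ∨ (αβ ≤ γ ∧ γ / α < η)) →
          ∃ C : ℝ, ∀ x : TameDomination.State n,
            TameDomination.returnMoment β hκ hm hn (fun t => (t : ℝ) ^ (1 / η)) x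
              ≤ ENNReal.ofReal (C * (x.1.1 : ℝ) ^ α)) ∧
      -- subexponential moments
      (∀ γ : ℝ, 0 < γ →
        (fun z => (n z : ℝ)) ~[atTop]
          (fun z : TameDomination.Level κ => (Real.log (z : ℝ)) ^ γ) →
        ∀ α ∈ Set.Ioo (0 : ℝ) αβ, ∀ η : ℝ, 0 < η →
          η < ((1 + γ) * α⁻¹ * Real.log ((1 - α) / β ^ α)) ^ (1 / (1 + γ)) →
          ∃ C : ℝ, ∀ x : TameDomination.State n,
            TameDomination.returnMoment β hκ hm hn
                (fun t => Real.exp (η * α * (t : ℝ) ^ (1 / (1 + γ)))) x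
              ≤ ENNReal.ofReal (C * (x.1.1 : ℝ) ^ α)) ∧
      -- geometric moments, delay `1` above the return set
      ((∀ z : TameDomination.Level κ, κ / β < z → n z = 1) →
        ∀ α ∈ Set.Ioo (0 : ℝ) αβ,
          ∃ C : ℝ, ∀ x : TameDomination.State n,
            TameDomination.returnMoment β hκ hm hn (fun t => ((1 - α) * β ^ (-α)) ^ t) x
              ≤ ENNReal.ofReal (C * (x.1.1 : ℝ) ^ α)) ∧
      -- geometric moments, delay bounded by `N` above the return set
      (∀ N : ℕ, (∀ z : TameDomination.Level κ, κ / β < z → n z ≤ N) →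
        ∀ α ∈ Set.Ioo (0 : ℝ) αβ,
          ∃ C : ℝ, ∀ x : TameDomination.State n,
            TameDomination.returnMoment β hκ hm hn
                (fun t => ((1 - α) * β ^ (-α)) ^ ((t : ℝ) / N)) x
              ≤ ENNReal.ofReal (C * (x.1.1 : ℝ) ^ α)) := by
  have hβ1' : β < 1 := hβ1.trans (by simp)
  obtain ⟨αβ, hαβ, hroot⟩ := TameDomination.exists_log_eq_log_one_sub_div hβ0 hβ1
  have hdiv : ∀ α, (1 - α) / β ^ α = (1 - α) * β ^ (-α) := fun α => by
    rw [Real.rpow_neg hβ0.le, div_eq_mul_inv]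
  have hρ : ∀ α ∈ Set.Ioo 0 αβ, 1 < (1 - α) * β ^ (-α) := fun α hα =>
    TameDomination.one_lt_of_lt_root hβ0 hαβ hroot hα
  have hgeom : ∀ N : ℕ, (∀ z : TameDomination.Level κ, κ / β < z → n z ≤ N) →
      ∀ α ∈ Set.Ioo (0 : ℝ) αβ, ∃ C : ℝ, ∀ x : TameDomination.State n,
        TameDomination.returnMoment β hκ hm hn
            (fun t => ((1 - α) * β ^ (-α)) ^ ((t : ℝ) / N)) x
          ≤ ENNReal.ofReal (C * (x.1.1 : ℝ) ^ α) := by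
    intro N hN α hα
    -- Some level exceeds `κ / β`, and its delay is at least `1`, so `N` is positive.
    have hmem : max (min 1 κ) (κ / β + 1) ∈ Set.Ici (min 1 κ) := le_max_left (min 1 κ) _
    have hN0 : 0 < N := (hn _).trans (hN ⟨_, hmem⟩
      ((lt_add_one (κ / β)).trans_le (le_max_right (min 1 κ) (κ / β + 1))))
    exact TameDomination.exists_geometric_moment_le hβ0 hβ1' hκ hm hn hloc hα.1
      (hα.2.trans hαβ.2) (hρ α hα) hN0 hN
  refine ⟨αβ, hαβ, hroot, fun a ha h => ?_, ?_, ?_, ?_, hgeom⟩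
  · exact TameDomination.strictAntiOn_log_one_sub_div.injOn ha hαβ (h.symm.trans hroot)
  · intro γ hγ0 hγ α hα η hη
    have hγη : γ / α < η := by rcases hη with h | h <;> tauto
    have hη0 : 0 < η := (div_nonneg hγ0 hα.1.le).trans_lt hγη
    rw [div_lt_iff₀' hα.1] at hγη
    have hαη : 0 < α * η := mul_pos hα.1 hη0
    obtain ⟨b, hb0, hb⟩ := TameDomination.exists_delay_le_mul_rpow hκ hloc hγ hγη.le hαη.le
    -- Only `γ / α < η` is needed from the two cases; the order `1 / η` of the moment decides
    -- between Minkowski and subadditivity.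
    rcases le_total η 1 with hη1 | hη1
    · exact TameDomination.exists_convex_moment_le hβ0 hκ hm hn hloc hα.1
        (hα.2.trans hαβ.2) (hρ α hα) hη0 hη1 hb0 hb
    · refine TameDomination.exists_concave_moment_le hβ0 hκ hm hn hloc hα.1
        (hα.2.trans hαβ.2) (hρ α hα) (b := b ^ (1 / η)) (by positivity)
        (by rwa [div_le_one hη0]) (by positivity) fun z => ?_
      have hz := TameDomination.level_pos hκ z
      calc (n z : ℝ) ^ (1 / η) ≤ (b * (z : ℝ) ^ (α * η)) ^ (1 / η) :=
            Real.rpow_le_rpow (by positivity) (hb z) (by positivity)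
        _ = _ := by
            rw [Real.mul_rpow hb0.le (by positivity), ← Real.rpow_mul hz.le, mul_assoc,
              mul_one_div_cancel hη0.ne', mul_one]
  · intro γ hγ hnγ α hα η hη0 hη
    rw [hdiv] at hη
    exact TameDomination.exists_subexponential_moment_le hβ0 hβ1' hκ hm hn hloc hα.1
      (hα.2.trans hαβ.2) (hρ α hα) hγ hnγ hη0 hη
  · intro h1 α hα
    have h := hgeom 1 (fun z hz => (h1 z hz).le) α hα
    simpa only [Nat.cast_one, div_one, Real.rpow_natCast] using h
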